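/- For $w=w_1w_2\cdots w_n\in S_n$ let $\mathrm{is}(w)$ be the maximal length of an increasing subsequence of $w$, and let $\mathrm{maj}(w)=\sum_{1\le i<n,\ w_i>w_{i+1}} i$ be its major index. For $0\le k\le n$ let $$\Pi_{n,k}=\{w\in S_n : w_1<w_2<\cdots<w_{n-k},\ \mathrm{is}(w)=n-k\},$$ and let $[m]_q=\frac{1-q^m}{1-q}=1+q+\cdots+q^{m-1}$. Then for all integers $k\ge 0$ and $n\ge 2k$, $$\sum_{s=0}^{k}\binom{k}{s}\sum_{w\in\Pi_{n,k-s}} q^{\mathrm{maj}(w^{-1})}=[n]_q[n-1]_q\cdots[n-k+1]_q ,$$ where the right-hand side is $1$ for $k=0$. The identity holds for the indeterminate $q$, and equivalently for every element $q$ of every commutative ring, with $[m]_q$ read as $1+q+\cdots+q^{m-1}$. -/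

import Mathlib

/-- The `q`-integer `[m]_q = 1 + q + ⋯ + q ^ (m - 1)`, in an arbitrary commutative ring. -/
def qInt {R : Type*} [CommRing R] (q : R) (m : ℕ) : R :=
  ∑ i ∈ Finset.range m, q ^ i

/-- In a field, for `q ≠ 1`, the `q`-integer is the quotient `(1 - q ^ m) / (1 - q)`. -/
theorem qInt_eq_div {K : Type*} [Field K] (q : K) (hq : q ≠ 1) (m : ℕ) :
    qInt q m = (1 - q ^ m) / (1 - q) := by
  have h : (1 : K) - q ≠ 0 := sub_ne_zero.mpr (Ne.symm hq)
  rw [eq_div_iff h]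
  exact geom_sum_mul_neg q m

/-- The major index `∑_{i : σ_i > σ_{i+1}} i` of a permutation. Positions are counted from `1` in
this formula, so the element `i` of `Fin n`, which is position `i + 1`, contributes `i + 1`. -/
def majorIndex {n : ℕ} (σ : Equiv.Perm (Fin n)) : ℕ :=
  ∑ i : Fin n, if ∃ h : (i : ℕ) + 1 < n, σ ⟨(i : ℕ) + 1, h⟩ < σ i then (i : ℕ) + 1 else 0

/-- `is(w)`, the maximal length of an increasing subsequence of `w`; a subsequence is given by the
set `s` of its positions. -/
def maxIncreasing {n : ℕ} (w : Equiv.Perm (Fin n)) : ℕ :=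
  ((Finset.univ : Finset (Finset (Fin n))).filter
    (fun s => ∀ i ∈ s, ∀ j ∈ s, i < j → w i < w j)).sup Finset.card

/-- `Π_{n,k}`: the permutations `w` of an `n`-element set whose first `n - k` entries are
increasing and whose longest increasing subsequence has length `n - k` (used for `k ≤ n`). -/
def PiSet (n k : ℕ) : Finset (Equiv.Perm (Fin n)) :=
  Finset.univ.filter (fun w =>
    (∀ i j : Fin n, i < j → (j : ℕ) < n - k → w i < w j) ∧ maxIncreasing w = n - k)

/-! Split a word whose first `n - k` letters increase into a row and `k` further letters, and
row-insert these letters one at a time as in the Robinson–Schensted algorithm. A letter larger than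
the whole row extends it; any other letter x replaces the smallest row entry y > x, and y is written
just before the row. Such a bump is a composite of Knuth moves: for no d does it alter whether d
precedes d - 1, so it keeps the inverse major index, and it keeps every bound on the lengths of
increasing subsequences.

In `stage n j m` the bumped letters and the row together have no increasing subsequence longer than
m. This makes bumping invertible: the last bumped letter y cannot lie below the whole row, so it can
be un-inserted. Hence the sum of a bump-invariant function over `stage n j m` is its sum over `stage
n j (m + 1)` (the row grew) plus its sum over `stage n (j + 1) m` (a bump). This is Pascal's
recursion, and k steps from `stage n 0 (n - k)` give binomial(k, a) times the sum over `stage n a (n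
- a)` (`sum_stage`). The recursion needs j ≤ m throughout, which is where n ≥ 2k enters.

Two evaluations remain. The initial sum is the product of q-integers, by appending the last k
letters with Carlitz's insertion lemma (`sum_stage_zero_pow_inverseMajor`). A terminal sum is the
sum over Π_{n,a} (`sum_PiSet`): expand `stage n 0 (n - a)` again, with the weight restricted to
words without increasing subsequences longer than n - a. Every terminal stage with a longer row then
vanishes, and only `stage n a (n - a)` is left. -/

/-- The words that use each of the letters `0, …, n - 1` exactly once. -/
def words (n : ℕ) : Finset (List ℕ) := (List.range n).permutations.toFinset

theorem mem_words {n : ℕ} {w : List ℕ} : w ∈ words n ↔ w.Perm (List.range n) := by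
  simp [words, List.mem_permutations]

theorem length_of_mem_words {n : ℕ} {w : List ℕ} (h : w ∈ words n) : w.length = n := by
  simpa using (mem_words.1 h).length_eq

theorem nodup_of_mem_words {n : ℕ} {w : List ℕ} (h : w ∈ words n) : w.Nodup :=
  (mem_words.1 h).nodup_iff.2 List.nodup_range

/-- All increasing subsequences of `w` have length at most `m`. -/
def IncLE (m : ℕ) (w : List ℕ) : Prop :=
  ∀ s : List ℕ, s.Sublist w → s.Pairwise (· < ·) → s.length ≤ m

/-- The row insertion of `x` into the increasing row `r₁ ++ y :: r₂` bumps `y`. -/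
structure IsBump (r₁ : List ℕ) (y : ℕ) (r₂ : List ℕ) (x : ℕ) : Prop where
  row : (r₁ ++ y :: r₂).Pairwise (· < ·)
  lt : ∀ a ∈ r₁, a < x
  bump : x < y

/-! ### Bumping preserves the inverse major index -/

/-- The sum of the letters `d` of `w` that precede `d - 1`. -/
def inverseMajor (n : ℕ) (w : List ℕ) : ℕ :=
  ∑ d ∈ Finset.range n, if [d, d - 1].Sublist w then d else 0

theorem pair_sublist_append {a c : ℕ} {u v : List ℕ} :
    [a, c].Sublist (u ++ v) ↔ [a, c].Sublist u ∨ (a ∈ u ∧ c ∈ v) ∨ [a, c].Sublist v := by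
  constructor
  · intro h
    obtain ⟨s, t, hst, hs, ht⟩ := List.sublist_append_iff.1 h
    match s, hst with
    | [], hst => right; right; simpa [hst] using ht
    | [e], hst =>
      simp at hst
      obtain ⟨rfl, rfl⟩ := hst
      right; left; exact ⟨by simpa using hs, by simpa using ht⟩
    | [e, f], hst =>
      simp at hst
      obtain ⟨rfl, rfl, rfl⟩ := hst
      left; exact hs
    | e :: f :: g :: s, hst => simp at hst
  · rintro (h | ⟨h, h'⟩ | h)
    · exact h.trans (List.sublist_append_left _ _)
    · exact (List.singleton_sublist.2 h).append (List.singleton_sublist.2 h')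
    · exact h.trans (List.sublist_append_right _ _)

theorem pair_sublist_cons {a c x : ℕ} {v : List ℕ} :
    [a, c].Sublist (x :: v) ↔ (a = x ∧ c ∈ v) ∨ [a, c].Sublist v := by
  have := pair_sublist_append (a := a) (c := c) (u := [x]) (v := v)
  have h : ¬ [a, c].Sublist [x] := fun h => by simpa using h.length_le
  simpa [h] using this

theorem not_pair_sublist {d : ℕ} {r : List ℕ} (hr : r.Pairwise (· < ·)) :
    ¬ [d, d - 1].Sublist r := by
  intro h
  have := hr.sublist h
  simp at this
  omega

theorem pair_sublist_congr {a c : ℕ} {u v : List ℕ} (b l : List ℕ) (hm : ∀ e, e ∈ u ↔ e ∈ v)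
    (hp : [a, c].Sublist u ↔ [a, c].Sublist v) :
    [a, c].Sublist (b ++ u ++ l) ↔ [a, c].Sublist (b ++ v ++ l) := by
  simp only [pair_sublist_append, List.mem_append, hm, hp]

/-- Both sides amount to d = y and d - 1 = x: entries of `r₁` are below x, entries of `r₂` are above
y, and x < y, so no other pair out of order can consist of consecutive values. -/
theorem IsBump.pair_sublist_iff {r₁ r₂ : List ℕ} {d x y : ℕ} (h : IsBump r₁ y r₂ x)
    (hd : 0 < d) :
    [d, d - 1].Sublist (r₁ ++ y :: r₂ ++ [x]) ↔ [d, d - 1].Sublist (y :: (r₁ ++ x :: r₂)) := by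
  have h1 := h.lt
  have h2 := h.bump
  have h3 := h.row
  have n0 := not_pair_sublist (d := d) h3
  rw [List.pairwise_append, List.pairwise_cons] at h3
  obtain ⟨hr₁, ⟨hy, hr₂⟩, h12⟩ := h3
  have n1 := not_pair_sublist (d := d) hr₁
  have n2 := not_pair_sublist (d := d) hr₂
  have n3 : ¬ [d, d - 1].Sublist [x] := fun h => by simpa using h.length_le
  rw [pair_sublist_append, pair_sublist_cons (v := r₁ ++ x :: r₂)]
  simp only [n0, n1, n2, n3, pair_sublist_append, pair_sublist_cons, List.mem_append,
    List.mem_cons, List.not_mem_nil, false_or, or_false]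
  constructor
  · rintro ⟨hd' | hd' | hd', hx⟩
    · have := h1 _ hd'; omega
    · exact Or.inl ⟨hd', Or.inr (Or.inl hx)⟩
    · have := hy _ hd'; omega
  · rintro (⟨hd', hx | hx | hx⟩ | ⟨hd', hx | hx⟩ | ⟨hd', hx⟩)
    · have := h1 _ hx; omega
    · exact ⟨Or.inr (Or.inl hd'), hx⟩
    · have := hy _ hx; omega
    · have := h1 _ hd'; omega
    · have := h12 _ hd' _ (List.mem_cons_of_mem _ hx); omega
    · have := hy _ hx; omega

theorem IsBump.inverseMajor_eq {r₁ r₂ : List ℕ} {x y : ℕ} (h : IsBump r₁ y r₂ x) (n : ℕ)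
    (b l : List ℕ) :
    inverseMajor n (b ++ (r₁ ++ y :: r₂ ++ [x]) ++ l) =
      inverseMajor n (b ++ y :: (r₁ ++ x :: r₂) ++ l) := by
  unfold inverseMajor
  refine Finset.sum_congr rfl fun d _ => ?_
  rcases Nat.eq_zero_or_pos d with rfl | hd
  · simp
  congr 1
  refine propext (pair_sublist_congr b l (fun e => ?_) (h.pair_sublist_iff hd))
  simp only [List.mem_append, List.mem_cons, List.not_mem_nil]
  tauto

/-! ### Bumping preserves bounds on increasing subsequences -/

theorem IncLE.mono {m m' : ℕ} {u v : List ℕ} (h : IncLE m v) (hu : u.Sublist v) (hm : m ≤ m') :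
    IncLE m' u :=
  fun s hs hp => (h s (hs.trans hu) hp).trans hm

/-- If each increasing subsequence of `u` can be traded for one of `v` that has the same length and
lies within the same bounds, then `u` can be replaced by `v` inside a word. -/
theorem IncLE.of_trade {m : ℕ} {u v b l : List ℕ} (h : IncLE m (b ++ v ++ l))
    (H : ∀ s : List ℕ, s.Sublist u → s.Pairwise (· < ·) → ∃ t : List ℕ, t.Sublist v ∧
      t.Pairwise (· < ·) ∧ t.length = s.length ∧ (∀ c ∈ t, ∃ a ∈ s, a ≤ c) ∧
      ∀ c ∈ t, ∃ a ∈ s, c ≤ a) : IncLE m (b ++ u ++ l) := by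
  intro s hs hp
  obtain ⟨s', sl, rfl, hs', hsl⟩ := List.sublist_append_iff.1 hs
  obtain ⟨sb, su, rfl, hsb, hsu⟩ := List.sublist_append_iff.1 hs'
  rw [List.pairwise_append, List.pairwise_append] at hp
  obtain ⟨⟨pb, pu, hbu⟩, pl, hul⟩ := hp
  obtain ⟨t, htv, pt, hlen, hge, hle⟩ := H su hsu pu
  have := h (sb ++ t ++ sl) ((hsb.append htv).append hsl) (by
    rw [List.pairwise_append, List.pairwise_append]
    refine ⟨⟨pb, pt, fun a ha c hc => ?_⟩, pl, fun a ha c hc => ?_⟩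
    · obtain ⟨e, he, hec⟩ := hge c hc
      exact (hbu a ha e he).trans_le hec
    · rcases List.mem_append.1 ha with ha | ha
      · exact hul a (by simp [ha]) c hc
      · obtain ⟨e, he, hec⟩ := hle a ha
        exact hec.trans_lt (hul e (by simp [he]) c hc))
  simpa [hlen] using this

/-- Most increasing subsequences occur unchanged on the other side. The exceptions use x followed by
some e in `r₂` (x becomes y, and x < y < e), or some e in `r₁` followed by y (y becomes x, and e < x
< y). The presence of e keeps the new letter within the old bounds. -/
theorem IsBump.incLE_iff {r₁ r₂ : List ℕ} {x y : ℕ} (h : IsBump r₁ y r₂ x) (m : ℕ)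
    (b l : List ℕ) :
    IncLE m (b ++ (r₁ ++ y :: r₂ ++ [x]) ++ l) ↔
      IncLE m (b ++ y :: (r₁ ++ x :: r₂) ++ l) := by
  have h1 := h.lt
  have h2 := h.bump
  have h3 := h.row
  rw [List.pairwise_append, List.pairwise_cons] at h3
  obtain ⟨hr₁, ⟨hy, hr₂⟩, h12⟩ := h3
  have same : ∀ s v : List ℕ, s.Sublist v → s.Pairwise (· < ·) → ∃ t : List ℕ, t.Sublist v ∧
      t.Pairwise (· < ·) ∧ t.length = s.length ∧ (∀ c ∈ t, ∃ a ∈ s, a ≤ c) ∧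
      ∀ c ∈ t, ∃ a ∈ s, c ≤ a := fun s v hs hp =>
    ⟨s, hs, hp, rfl, fun c hc => ⟨c, hc, le_rfl⟩, fun c hc => ⟨c, hc, le_rfl⟩⟩
  constructor <;> refine fun H => H.of_trade fun s hs hp => ?_
  · rcases List.sublist_cons_iff.1 hs with ks | ⟨s, rfl, ks⟩
    · obtain ⟨s₁, s₂, rfl, hs₁, hs₂⟩ := List.sublist_append_iff.1 ks
      rcases List.sublist_cons_iff.1 hs₂ with ks₂ | ⟨s₂, rfl, ks₂⟩
      · refine same _ _ ?_ hp
        simpa using hs₁.append ((ks₂.cons y).trans (List.sublist_append_left (y :: r₂) [x]))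
      · rcases s₂ with _ | ⟨e, s₂⟩
        · refine same _ _ ?_ hp
          exact (hs₁.trans (List.sublist_append_left _ _)).append (List.Sublist.refl _)
        · rw [List.pairwise_append, List.pairwise_cons] at hp
          obtain ⟨p₁, ⟨px, p₂⟩, p12⟩ := hp
          refine ⟨s₁ ++ y :: e :: s₂, ?_, ?_, by simp, fun c hc => ?_, fun c hc => ?_⟩
          · exact (hs₁.append (ks₂.cons_cons y)).trans (List.sublist_append_left _ _)
          · rw [List.pairwise_append, List.pairwise_cons]
            refine ⟨p₁, ⟨fun a ha => hy a (ks₂.subset ha), p₂⟩, fun a ha c hc => ?_⟩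
            exact h12 a (hs₁.subset ha) c ((ks₂.cons_cons y).subset hc)
          · rcases List.mem_append.1 hc with hc | hc
            · exact ⟨c, by simp [hc], le_rfl⟩
            · rcases List.mem_cons.1 hc with rfl | hc
              · exact ⟨x, by simp, h2.le⟩
              · exact ⟨c, List.mem_append_right _ (List.mem_cons_of_mem _ hc), le_rfl⟩
          · rcases List.mem_append.1 hc with hc | hc
            · exact ⟨c, by simp [hc], le_rfl⟩
            · rcases List.mem_cons.1 hc with rfl | hc
              · exact ⟨e, by simp, (hy e (ks₂.subset (by simp))).le⟩
              · exact ⟨c, List.mem_append_right _ (List.mem_cons_of_mem _ hc), le_rfl⟩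
    · refine same _ _ ?_ hp
      rw [List.pairwise_cons] at hp
      obtain ⟨s₁, s₂, rfl, hs₁, hs₂⟩ := List.sublist_append_iff.1 ks
      have e₁ : s₁ = [] := List.eq_nil_iff_forall_not_mem.2 fun a ha => by
        have := hp.1 a (by simp [ha])
        have := h1 a (hs₁.subset ha)
        omega
      rcases List.sublist_cons_iff.1 hs₂ with ks₂ | ⟨s₂, rfl, ks₂⟩
      · subst e₁
        simpa using ((List.nil_sublist r₁).append (ks₂.cons_cons y)).trans
          (List.sublist_append_left _ [x])
      · have := hp.1 x (by simp)
        omega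
  · obtain ⟨s', s₃, rfl, hs', hs₃⟩ := List.sublist_append_iff.1 hs
    obtain ⟨s₁, s₂, rfl, hs₁, hs₂⟩ := List.sublist_append_iff.1 hs'
    rcases List.sublist_cons_iff.1 hs₃ with ks₃ | ⟨s₃, rfl, ks₃⟩
    · obtain rfl := List.sublist_nil.1 ks₃
      rw [List.append_nil] at hp ⊢
      rcases List.sublist_cons_iff.1 hs₂ with ks₂ | ⟨s₂, rfl, ks₂⟩
      · exact same _ _ ((hs₁.append (ks₂.cons x)).cons y) hp
      · rcases s₁ with _ | ⟨e, s₁⟩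
        · refine same _ _ ?_ hp
          exact ((ks₂.cons x).trans (List.sublist_append_right _ _)).cons_cons y
        · rw [List.pairwise_append, List.pairwise_cons (a := y)] at hp
          obtain ⟨p₁, ⟨px, p₂⟩, p12⟩ := hp
          refine ⟨e :: s₁ ++ x :: s₂, ?_, ?_, by simp, fun c hc => ?_, fun c hc => ?_⟩
          · exact (hs₁.append (ks₂.cons_cons x)).cons y
          · rw [List.pairwise_append, List.pairwise_cons (a := x)]
            refine ⟨p₁, ⟨fun a ha => h2.trans (px a ha), p₂⟩, fun a ha c hc => ?_⟩
            rcases List.mem_cons.1 hc with rfl | hc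
            · exact h1 a (hs₁.subset ha)
            · exact p12 a ha c (by simp [hc])
          · rcases List.mem_append.1 hc with hc | hc
            · exact ⟨c, List.mem_append_left _ hc, le_rfl⟩
            · rcases List.mem_cons.1 hc with rfl | hc
              · exact ⟨e, by simp, (h1 e (hs₁.subset (by simp))).le⟩
              · exact ⟨c, by simp [hc], le_rfl⟩
          · rcases List.mem_append.1 hc with hc | hc
            · exact ⟨c, List.mem_append_left _ hc, le_rfl⟩
            · rcases List.mem_cons.1 hc with rfl | hc
              · exact ⟨y, by simp, h2.le⟩
              · exact ⟨c, by simp [hc], le_rfl⟩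
    · refine same _ _ ?_ hp
      obtain rfl := List.sublist_nil.1 ks₃
      rw [List.pairwise_append] at hp
      have e₂ : s₂ = [] := List.eq_nil_iff_forall_not_mem.2 fun a ha => by
        have h' := hp.2.2 a (by simp [ha]) x (by simp)
        rcases List.mem_cons.1 (hs₂.subset ha) with rfl | ha
        · omega
        · have := hy a ha; omega
      subst e₂
      rw [List.append_nil]
      exact (hs₁.append ((List.nil_sublist r₂).cons_cons x)).cons y

/-- An increasing subsequence ending in the final x avoids y and `r₂`, so its last letter can be
replaced by y, inside the row. -/
theorem IsBump.incLE_append_singleton_iff {r₁ r₂ : List ℕ} {x y : ℕ} (h : IsBump r₁ y r₂ x)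
    (m : ℕ) (b : List ℕ) :
    IncLE m (b ++ (r₁ ++ y :: r₂) ++ [x]) ↔ IncLE m (b ++ (r₁ ++ y :: r₂)) := by
  have h2 := h.bump
  have h3 := h.row
  rw [List.pairwise_append, List.pairwise_cons] at h3
  obtain ⟨hr₁, ⟨hy, hr₂⟩, h12⟩ := h3
  refine ⟨fun H => H.mono (List.sublist_append_left _ _) le_rfl, fun H s hs hp => ?_⟩
  obtain ⟨s', s₃, rfl, hs', hs₃⟩ := List.sublist_append_iff.1 hs
  obtain ⟨sb, s'', rfl, hsb, hs''⟩ := List.sublist_append_iff.1 hs'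
  obtain ⟨s₁, s₂, rfl, hs₁, hs₂⟩ := List.sublist_append_iff.1 hs''
  rcases List.sublist_cons_iff.1 hs₃ with ks₃ | ⟨s₃, rfl, ks₃⟩
  · obtain rfl := List.sublist_nil.1 ks₃
    rw [List.append_nil] at hp ⊢
    exact H _ hs' hp
  · obtain rfl := List.sublist_nil.1 ks₃
    rw [List.pairwise_append] at hp
    obtain ⟨p', -, px⟩ := hp
    have e₂ : s₂ = [] := List.eq_nil_iff_forall_not_mem.2 fun a ha => by
      have h' := px a (by simp [ha]) x (by simp)
      rcases List.mem_cons.1 (hs₂.subset ha) with rfl | ha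
      · omega
      · have := hy a ha; omega
    subst e₂
    rw [List.append_nil] at *
    have := H (sb ++ (s₁ ++ [y]))
      (hsb.append (hs₁.append ((List.nil_sublist r₂).cons_cons y))) (by
        rw [← List.append_assoc, List.pairwise_append]
        refine ⟨p', by simp, fun a ha c hc => ?_⟩
        obtain rfl := List.mem_singleton.1 hc
        exact (px a ha x (by simp)).trans h2)
    simpa [add_assoc] using this

theorem IsBump.incLE_row_iff {r₁ r₂ : List ℕ} {x y : ℕ} (h : IsBump r₁ y r₂ x)
    (m : ℕ) (b : List ℕ) :
    IncLE m (b ++ (r₁ ++ y :: r₂)) ↔ IncLE m (b ++ y :: (r₁ ++ x :: r₂)) := by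
  rw [← h.incLE_append_singleton_iff, ← List.append_nil (b ++ y :: _), ← h.incLE_iff]
  simp

/-! ### Stages of the insertion process -/

/-- The words in `words n` that consist of `j` bumped letters, an increasing row of length `m`, and
letters still to be inserted, such that the bumped letters and the row together contain no
increasing subsequence longer than the row. -/
noncomputable def stage (n j m : ℕ) : Finset (List ℕ) :=
  open Classical in (words n).filter fun w =>
    ((w.drop j).take m).Pairwise (· < ·) ∧ IncLE m (w.take (j + m))

theorem mem_stage {n j m : ℕ} {w : List ℕ} : w ∈ stage n j m ↔
    w ∈ words n ∧ ((w.drop j).take m).Pairwise (· < ·) ∧ IncLE m (w.take (j + m)) := by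
  classical
  rw [stage, Finset.mem_filter]

theorem append_mem_stage {n j m : ℕ} {b r l : List ℕ} (hb : b.length = j) (hr : r.length = m) :
    b ++ r ++ l ∈ stage n j m ↔
      b ++ r ++ l ∈ words n ∧ r.Pairwise (· < ·) ∧ IncLE m (b ++ r) := by
  subst hb hr
  rw [mem_stage, ← List.length_append, List.take_left, List.append_assoc,
    List.drop_left, List.take_left]

theorem exists_append_of_length {j m n : ℕ} (h : j + m ≤ n) {w : List ℕ} (hw : w.length = n) :
    ∃ b r l : List ℕ, w = b ++ r ++ l ∧ b.length = j ∧ r.length = m ∧ l.length = n - (j + m) := by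
  refine ⟨w.take j, (w.drop j).take m, (w.drop j).drop m, by simp, ?_, ?_, ?_⟩ <;> simp <;> omega

theorem stage_subset_words (n j m : ℕ) : stage n j m ⊆ words n :=
  fun _ hw => (mem_stage.1 hw).1

/-- Let x be the last entry of the longer row. An increasing subsequence that avoids x but meets the
row can be prolonged by x, so its length is at most m; one that misses the row has length at most j
≤ m. -/
theorem stage_succ_subset {n j m : ℕ} (hj : j ≤ m) (h : j + m < n) :
    stage n j (m + 1) ⊆ stage n j m := by
  intro w hw
  obtain ⟨b, r, l, rfl, hb, hr, -⟩ := exists_append_of_length (j := j) (m := m + 1) h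
    (length_of_mem_words (stage_subset_words _ _ _ hw))
  obtain ⟨hw, hp, hi⟩ := (append_mem_stage hb hr).1 hw
  obtain rfl | ⟨r, x, rfl⟩ := r.eq_nil_or_concat
  · simp at hr
  rw [List.concat_eq_append] at *
  have hr' : r.length = m := by simpa using hr
  have e : b ++ (r ++ [x]) ++ l = b ++ r ++ x :: l := by simp
  rw [e] at hw ⊢
  rw [List.pairwise_append] at hp
  refine (append_mem_stage hb hr').2 ⟨hw, hp.1, fun s hs hsp => ?_⟩
  obtain ⟨sb, sr, rfl, hsb, hsr⟩ := List.sublist_append_iff.1 hs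
  rcases sr with _ | ⟨c, sr⟩
  · have := hsb.length_le
    simp
    omega
  · rw [List.pairwise_append] at hsp
    have hx : ∀ a ∈ c :: sr, a < x := fun a ha => hp.2.2 a (hsr.subset ha) x (by simp)
    have := hi (sb ++ (c :: sr ++ [x])) (hsb.append (hsr.append (List.Sublist.refl _))) (by
      rw [List.pairwise_append, List.pairwise_append]
      refine ⟨hsp.1, ⟨hsp.2.1, by simp, by simpa using hx⟩, fun a ha e he => ?_⟩
      rcases List.mem_append.1 he with he | he
      · exact hsp.2.2 a ha e he
      · obtain rfl := List.mem_singleton.1 he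
        exact (hsp.2.2 a ha c (by simp)).trans (hx c (by simp)))
    simp at this ⊢
    omega

/-! ### Row insertion and its inverse -/

theorem exists_isBump_of_insert {r : List ℕ} {x : ℕ} (hr : r.Pairwise (· < ·)) (hx : x ∉ r)
    (h : ∃ a ∈ r, x < a) : ∃ r₁ y r₂, r = r₁ ++ y :: r₂ ∧ IsBump r₁ y r₂ x := by
  induction r with
  | nil => simp at h
  | cons a r ih =>
    rcases lt_trichotomy a x with hax | rfl | hax
    · obtain ⟨r₁, y, r₂, rfl, hB⟩ := ih (List.pairwise_cons.1 hr).2 (fun h => hx (by simp [h])) (by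
        obtain ⟨c, hc, hxc⟩ := h
        rcases List.mem_cons.1 hc with rfl | hc
        · omega
        · exact ⟨c, hc, hxc⟩)
      exact ⟨a :: r₁, y, r₂, rfl, hr, by simpa using ⟨hax, hB.lt⟩, hB.bump⟩
    · simp at hx
    · exact ⟨[], a, r, rfl, hr, by simp, hax⟩

/-- Reverse row insertion: y goes back in place of the largest entry below it. -/
theorem exists_isBump_of_uninsert {r : List ℕ} {y : ℕ} (hr : r.Pairwise (· < ·)) (hy : y ∉ r)
    (h : ∃ a ∈ r, a < y) : ∃ r₁ x r₂, r = r₁ ++ x :: r₂ ∧ IsBump r₁ y r₂ x := by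
  induction r with
  | nil => simp at h
  | cons a r ih =>
    have hr' := List.pairwise_cons.1 hr
    by_cases h' : ∃ c ∈ r, c < y
    · obtain ⟨r₁, x, r₂, rfl, hB⟩ := ih hr'.2 (fun h => hy (by simp [h])) h'
      refine ⟨a :: r₁, x, r₂, rfl, List.pairwise_cons.2 ⟨fun c hc => ?_, hB.row⟩, ?_, hB.bump⟩
      · rcases List.mem_append.1 hc with hc | hc
        · exact hr'.1 c (by simp [hc])
        · rcases List.mem_cons.1 hc with rfl | hc
          · exact (hr'.1 x (by simp)).trans hB.bump
          · exact hr'.1 c (by simp [hc])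
      · intro c hc
        rcases List.mem_cons.1 hc with rfl | hc
        · exact hr'.1 x (by simp)
        · exact hB.lt c hc
    · push Not at h'
      obtain ⟨c, hc, hcy⟩ := h
      rcases List.mem_cons.1 hc with rfl | hc
      · refine ⟨[], c, r, rfl, List.pairwise_cons.2 ⟨fun e he => ?_, hr'.2⟩, by simp, hcy⟩
        have := h' e he
        have : e ≠ y := fun h => hy (by simp [← h, he])
        omega
      · have := h' c hc
        omega

theorem IsBump.insert_unique {r₁ r₂ r₁' r₂' : List ℕ} {x y y' : ℕ} (h : IsBump r₁ y r₂ x)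
    (h' : IsBump r₁' y' r₂' x) (e : r₁ ++ y :: r₂ = r₁' ++ y' :: r₂') :
    r₁ = r₁' ∧ y = y' ∧ r₂ = r₂' := by
  have k := h.lt
  have k' := h'.lt
  rcases List.append_eq_append_iff.1 e with ⟨t, rfl, ht⟩ | ⟨t, rfl, ht⟩
  · rcases t with _ | ⟨a, t⟩
    · simpa using ht
    · simp only [List.cons_append, List.cons.injEq] at ht
      have := k' a (by simp)
      have := h.bump
      omega
  · rcases t with _ | ⟨a, t⟩
    · simpa [eq_comm] using ht
    · simp only [List.cons_append, List.cons.injEq] at ht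
      have := k a (by simp)
      have := h'.bump
      omega

theorem IsBump.gt {r₁ r₂ : List ℕ} {x y : ℕ} (h : IsBump r₁ y r₂ x) : ∀ a ∈ r₂, y < a := by
  have h3 := h.row
  rw [List.pairwise_append, List.pairwise_cons] at h3
  exact h3.2.1.1

theorem IsBump.uninsert_unique {r₁ r₂ r₁' r₂' : List ℕ} {x x' y : ℕ} (h : IsBump r₁ y r₂ x)
    (h' : IsBump r₁' y r₂' x') (e : r₁ ++ x :: r₂ = r₁' ++ x' :: r₂') :
    r₁ = r₁' ∧ x = x' ∧ r₂ = r₂' := by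
  have k := h.gt
  have k' := h'.gt
  rcases List.append_eq_append_iff.1 e with ⟨t, rfl, ht⟩ | ⟨t, rfl, ht⟩
  · rcases t with _ | ⟨a, t⟩
    · simpa using ht
    · simp only [List.cons_append, List.cons.injEq] at ht
      have := k x' (by simp [ht.2])
      have := h'.bump
      omega
  · rcases t with _ | ⟨a, t⟩
    · simpa [eq_comm] using ht
    · simp only [List.cons_append, List.cons.injEq] at ht
      have := k' x (by simp [ht.2])
      have := h.bump
      omega

theorem IsBump.row_bumped {r₁ r₂ : List ℕ} {x y : ℕ} (h : IsBump r₁ y r₂ x) :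
    (r₁ ++ x :: r₂).Pairwise (· < ·) := by
  have h3 := h.row
  rw [List.pairwise_append, List.pairwise_cons] at h3 ⊢
  refine ⟨h3.1, ⟨fun a ha => h.bump.trans (h.gt a ha), h3.2.1.2⟩, fun a ha c hc => ?_⟩
  rcases List.mem_cons.1 hc with rfl | hc
  · exact h.lt a ha
  · exact h3.2.2 a ha c (by simp [hc])

/-- The words `w` and `w'` are related by one row insertion into the row of length `m` that
starts after `j` letters of `w`. -/
def BumpRel (j m : ℕ) (w w' : List ℕ) : Prop :=
  ∃ b r₁ y r₂ x l, b.length = j ∧ (r₁ ++ y :: r₂).length = m ∧ IsBump r₁ y r₂ x ∧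
    w = b ++ (r₁ ++ y :: r₂ ++ [x]) ++ l ∧ w' = b ++ y :: (r₁ ++ x :: r₂) ++ l

theorem BumpRel.mem_words_iff {n j m : ℕ} {w w' : List ℕ} (h : BumpRel j m w w') :
    w ∈ words n ↔ w' ∈ words n := by
  obtain ⟨b, r₁, y, r₂, x, l, -, -, -, rfl, rfl⟩ := h
  have : (b ++ (r₁ ++ y :: r₂ ++ [x]) ++ l).Perm (b ++ y :: (r₁ ++ x :: r₂) ++ l) := by
    rw [List.perm_iff_count]
    intro a
    simp only [List.count_append, List.count_cons, List.count_nil]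
    omega
  rw [mem_words, mem_words]
  exact ⟨this.symm.trans, this.trans⟩

theorem BumpRel.right_unique {j m : ℕ} {w w' w'' : List ℕ} (h : BumpRel j m w w')
    (h' : BumpRel j m w w'') : w' = w'' := by
  obtain ⟨b, r₁, y, r₂, x, l, hb, hr, hB, rfl, rfl⟩ := h
  obtain ⟨b', r₁', y', r₂', x', l', hb', hr', hB', e, rfl⟩ := h'
  rw [List.append_assoc, List.append_assoc, List.append_assoc b', List.append_assoc _ [x']] at e
  obtain ⟨rfl, e₁⟩ := List.append_inj e (hb.trans hb'.symm)
  obtain ⟨e₂, e'⟩ := List.append_inj e₁ (hr.trans hr'.symm)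
  simp only [List.singleton_append, List.cons.injEq] at e'
  obtain ⟨rfl, rfl⟩ := e'
  obtain ⟨rfl, rfl, rfl⟩ := hB.insert_unique hB' e₂
  rfl

theorem BumpRel.left_unique {j m : ℕ} {w w' w'' : List ℕ} (h : BumpRel j m w' w)
    (h' : BumpRel j m w'' w) : w' = w'' := by
  obtain ⟨b, r₁, y, r₂, x, l, hb, hr, hB, rfl, rfl⟩ := h
  obtain ⟨b', r₁', y', r₂', x', l', hb', hr', hB', rfl, e⟩ := h'
  rw [List.append_assoc, List.append_assoc] at e
  obtain ⟨rfl, e₁⟩ := List.append_inj e (hb.trans hb'.symm)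
  simp only [List.cons_append, List.cons.injEq] at e₁
  obtain ⟨rfl, e₂⟩ := e₁
  obtain ⟨e₃, rfl⟩ := List.append_inj (s₁ := r₁ ++ x :: r₂) (s₂ := r₁' ++ x' :: r₂')
    (by simpa using e₂) (by simpa using hr.trans hr'.symm)
  obtain ⟨rfl, rfl, rfl⟩ := hB.uninsert_unique hB' e₃
  rfl

/-- If the next letter exceeded the whole row, it would extend the row and raise the bound on
increasing subsequences by at most one, so the word would lie in the excluded stage. Hence the
letter bumps. -/
theorem exists_bumpRel_of_mem {n j m : ℕ} (h : j + m < n) {w : List ℕ} (hw : w ∈ stage n j m)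
    (hw' : w ∉ stage n j (m + 1)) : ∃ w' ∈ stage n (j + 1) m, BumpRel j m w w' := by
  obtain ⟨b, r, l, rfl, hb, hr, hl⟩ := exists_append_of_length (j := j) (m := m) h.le
    (length_of_mem_words (stage_subset_words _ _ _ hw))
  obtain ⟨hw, hp, hi⟩ := (append_mem_stage hb hr).1 hw
  rcases l with _ | ⟨x, l⟩
  · simp at hl
    omega
  have hnd : x ∉ r := by
    have := nodup_of_mem_words hw
    rw [List.append_assoc, List.nodup_append] at this
    have := (List.nodup_append.1 this.2.1).2.2
    exact fun hx => this x hx x (by simp) rfl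
  have hx : ∃ a ∈ r, x < a := by
    by_contra! hx
    have e : b ++ r ++ x :: l = b ++ (r ++ [x]) ++ l := by simp
    rw [e] at hw hw'
    refine hw' ((append_mem_stage hb (by simp [hr])).2 ⟨hw, ?_, fun s hs hsp => ?_⟩)
    · rw [List.pairwise_append]
      refine ⟨hp, by simp, fun a ha c hc => ?_⟩
      obtain rfl := List.mem_singleton.1 hc
      exact lt_of_le_of_ne (hx a ha) fun h => hnd (h ▸ ha)
    · rw [← List.append_assoc] at hs
      obtain ⟨s₁, s₂, rfl, hs₁, hs₂⟩ := List.sublist_append_iff.1 hs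
      have h1 := hi s₁ hs₁ (List.pairwise_append.1 hsp).1
      have h2 := hs₂.length_le
      simp at h2 ⊢
      omega
  obtain ⟨r₁, y, r₂, rfl, hB⟩ := exists_isBump_of_insert hp hnd hx
  have hR : BumpRel j m (b ++ (r₁ ++ y :: r₂) ++ x :: l) (b ++ y :: (r₁ ++ x :: r₂) ++ l) :=
    ⟨b, r₁, y, r₂, x, l, hb, hr, hB, by simp, rfl⟩
  refine ⟨_, ?_, hR⟩
  have e : b ++ y :: (r₁ ++ x :: r₂) = (b ++ [y]) ++ (r₁ ++ x :: r₂) := by simp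
  have hw2 := hR.mem_words_iff.1 hw
  rw [e] at hw2 ⊢
  refine (append_mem_stage (by simp [hb]) (by simpa using hr)).2 ⟨hw2, hB.row_bumped, ?_⟩
  rw [← e]
  exact (hB.incLE_row_iff m b).1 hi

theorem exists_bumpRel_to_mem {n j m : ℕ} (h : j + m < n) {w' : List ℕ}
    (hw : w' ∈ stage n (j + 1) m) :
    ∃ w ∈ stage n j m, w ∉ stage n j (m + 1) ∧ BumpRel j m w w' := by
  obtain ⟨b, r, l, rfl, hb, hr, hl⟩ := exists_append_of_length (j := j + 1) (m := m) (by omega)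
    (length_of_mem_words (stage_subset_words _ _ _ hw))
  obtain ⟨hw, hp, hi⟩ := (append_mem_stage hb hr).1 hw
  obtain rfl | ⟨b, y, rfl⟩ := b.eq_nil_or_concat
  · simp at hb
  rw [List.concat_eq_append] at *
  have hnd : y ∉ r := by
    have := nodup_of_mem_words hw
    have := (List.nodup_append.1 (List.nodup_append.1 this).1).2.2
    exact fun hx => this y (by simp) y hx rfl
  -- Otherwise y followed by the row would be an increasing subsequence of length m + 1.
  have hy : ∃ a ∈ r, a < y := by
    by_contra! hy
    have := hi (y :: r) (by simp) (List.pairwise_cons.2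
      ⟨fun a ha => lt_of_le_of_ne (hy a ha) fun h => hnd (h ▸ ha), hp⟩)
    simp at this
    omega
  obtain ⟨r₁, x, r₂, rfl, hB⟩ := exists_isBump_of_uninsert hp hnd hy
  have hb' : b.length = j := by simpa using hb
  have hr' : (r₁ ++ y :: r₂).length = m := by simpa using hr
  have e : b ++ [y] ++ (r₁ ++ x :: r₂) = b ++ y :: (r₁ ++ x :: r₂) := by simp
  rw [e] at hw hi ⊢
  have e' : b ++ (r₁ ++ y :: r₂ ++ [x]) ++ l = b ++ (r₁ ++ y :: r₂) ++ x :: l := by simp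
  have hR : BumpRel j m (b ++ (r₁ ++ y :: r₂ ++ [x]) ++ l) (b ++ y :: (r₁ ++ x :: r₂) ++ l) :=
    ⟨b, r₁, y, r₂, x, l, hb', hr', hB, rfl, rfl⟩
  have hw2 := hR.mem_words_iff.2 hw
  refine ⟨_, ?_, fun hw3 => ?_, hR⟩
  · rw [e'] at hw2 ⊢
    exact (append_mem_stage hb' hr').2 ⟨hw2, hB.row, (hB.incLE_row_iff m b).2 hi⟩
  · have := ((append_mem_stage hb' (by simp at hr' ⊢; omega)).1 hw3).2.1
    have := (List.pairwise_append.1 this).2.2 y (by simp) x (by simp)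
    have := hB.bump
    omega

/-! ### Pascal's recursion for sums over stages -/

/-- A function on words that is unchanged by the bumping of a letter. -/
def BumpInvariant {M : Type*} (g : List ℕ → M) : Prop :=
  ∀ j m w w', BumpRel j m w w' → g w = g w'

theorem sum_stage_sdiff {M : Type*} [AddCommMonoid M] {g : List ℕ → M} (hg : BumpInvariant g)
    {n j m : ℕ} (h : j + m < n) :
    ∑ w ∈ stage n j m \ stage n j (m + 1), g w = ∑ w ∈ stage n (j + 1) m, g w := by
  have H : ∀ w ∈ stage n j m \ stage n j (m + 1), ∃ w' ∈ stage n (j + 1) m, BumpRel j m w w' :=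
    fun w hw => exists_bumpRel_of_mem h (Finset.mem_sdiff.1 hw).1 (Finset.mem_sdiff.1 hw).2
  choose f hf hR using H
  refine Finset.sum_bij f hf (fun w hw v hv e => ?_) (fun w' hw' => ?_) fun w hw => ?_
  · exact (hR w hw).left_unique (e ▸ hR v hv)
  · obtain ⟨w, hw, hw1, hR'⟩ := exists_bumpRel_to_mem h hw'
    exact ⟨w, Finset.mem_sdiff.2 ⟨hw, hw1⟩, (hR w _).right_unique hR'⟩
  · exact hg j m _ _ (hR w hw)

theorem sum_stage_step {M : Type*} [AddCommMonoid M] {g : List ℕ → M} (hg : BumpInvariant g)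
    {n j m : ℕ} (hj : j ≤ m) (h : j + m < n) :
    ∑ w ∈ stage n j m, g w = ∑ w ∈ stage n j (m + 1), g w + ∑ w ∈ stage n (j + 1) m, g w := by
  rw [← sum_stage_sdiff hg h, add_comm, Finset.sum_sdiff (stage_succ_subset hj h)]

/-- Here i is the number of letters still to be inserted, a.1 of which bump and a.2 of which extend
the row. The condition j + i ≤ m guarantees j ≤ m at every step, even if all letters bump. -/
theorem sum_stage {R : Type*} [CommRing R] {g : List ℕ → R} (hg : BumpInvariant g) {n i : ℕ} :
    ∀ {j m : ℕ}, j + m + i = n → j + i ≤ m → ∑ w ∈ stage n j m, g w =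
      ∑ a ∈ Finset.HasAntidiagonal.antidiagonal i, (i.choose a.1 : R) *
        ∑ w ∈ stage n (j + a.1) (m + a.2), g w := by
  induction i with
  | zero => simp
  | succ i ih =>
    intro j m h h'
    rw [sum_stage_step hg (by omega) (by omega), ih (by omega) (by omega),
      ih (by omega) (by omega),
      Finset.sum_antidiagonal_choose_succ_mul
        (fun a c => ∑ w ∈ stage n (j + a) (m + c), g w)]
    congr 1
    · refine Finset.sum_congr rfl fun a _ => ?_
      rw [add_right_comm, add_assoc]
    · refine Finset.sum_congr rfl fun a ha => ?_
      rw [add_right_comm, add_assoc,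
        Nat.choose_symm_of_eq_add (Finset.HasAntidiagonal.mem_antidiagonal.1 ha).symm]

/-! ### Appending a letter and Carlitz's lemma -/

theorem mem_words_iff_nodup {n : ℕ} {w : List ℕ} :
    w ∈ words n ↔ w.Nodup ∧ ∀ a, a ∈ w ↔ a < n := by
  rw [mem_words]
  refine ⟨fun h => ⟨h.nodup_iff.2 List.nodup_range, fun a => by simp [h.mem_iff]⟩, fun h => ?_⟩
  exact (List.perm_ext_iff_of_nodup h.1 List.nodup_range).2 (by simpa using h.2)

theorem mem_stage_zero {n m : ℕ} {w : List ℕ} :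
    w ∈ stage n 0 m ↔ w ∈ words n ∧ (w.take m).Pairwise (· < ·) := by
  rw [mem_stage, List.drop_zero, zero_add]
  exact ⟨fun h => ⟨h.1, h.2.1⟩, fun h => ⟨h.1, h.2, fun s hs _ =>
    hs.length_le.trans (List.length_take_le _ _)⟩⟩

/-- The order embedding of `ℕ` into itself that omits the value `x`. -/
def skip (x v : ℕ) : ℕ := if v < x then v else v + 1

theorem skip_strictMono (x : ℕ) : StrictMono (skip x) := by
  intro a b h
  unfold skip
  split_ifs <;> omega

theorem skip_ne (x v : ℕ) : skip x v ≠ x := by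
  unfold skip
  split_ifs <;> omega

theorem skip_of_lt {x v : ℕ} (h : v < x) : skip x v = v := if_pos h

theorem skip_of_le {x v : ℕ} (h : x ≤ v) : skip x v = v + 1 := if_neg (by omega)

theorem exists_skip_eq {x v : ℕ} (h : v ≠ x) : ∃ u, skip x u = v := by
  rcases lt_or_gt_of_ne h with h | h
  · exact ⟨v, skip_of_lt h⟩
  · exact ⟨v - 1, (skip_of_le (by omega)).trans (by omega)⟩

theorem skip_lt_succ_iff {x n v : ℕ} (hx : x ≤ n) : skip x v < n + 1 ↔ v < n := by
  unfold skip
  split_ifs <;> omega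

/-- The word with last letter `x` whose other letters are in the same relative order as `w`. -/
def appendLetter (x : ℕ) (w : List ℕ) : List ℕ := w.map (skip x) ++ [x]

theorem notMem_map_skip (x : ℕ) (w : List ℕ) : x ∉ w.map (skip x) := by
  simp [skip_ne]

theorem appendLetter_mem_words {n x : ℕ} (hx : x ≤ n) {w : List ℕ} :
    appendLetter x w ∈ words (n + 1) ↔ w ∈ words n := by
  rw [mem_words_iff_nodup, mem_words_iff_nodup, appendLetter, List.nodup_append,
    List.nodup_map_iff (skip_strictMono x).injective]
  constructor
  · rintro ⟨⟨h, -, -⟩, h'⟩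
    refine ⟨h, fun a => ?_⟩
    rw [← skip_lt_succ_iff hx, ← h', List.mem_append,
      List.mem_map_of_injective (skip_strictMono x).injective]
    simp [skip_ne]
  · rintro ⟨h, h'⟩
    refine ⟨⟨h, by simp, ?_⟩, fun a => ?_⟩
    · simp [skip_ne]
    · rcases eq_or_ne a x with rfl | hax
      · simp
        omega
      · obtain ⟨u, rfl⟩ := exists_skip_eq hax
        rw [skip_lt_succ_iff hx, List.mem_append,
          List.mem_map_of_injective (skip_strictMono x).injective, h']
        simp [skip_ne]

theorem appendLetter_injective {x x' : ℕ} {w w' : List ℕ}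
    (h : appendLetter x w = appendLetter x' w') : x = x' ∧ w = w' := by
  obtain ⟨h₁, h₂⟩ := List.append_inj' h rfl
  obtain rfl : x = x' := by simpa using h₂
  exact ⟨rfl, List.map_injective_iff.2 (skip_strictMono x).injective h₁⟩

theorem exists_appendLetter_eq {n : ℕ} {w : List ℕ} (hw : w ∈ words (n + 1)) :
    ∃ x ≤ n, ∃ w' ∈ words n, appendLetter x w' = w := by
  obtain ⟨hnd, hmem⟩ := mem_words_iff_nodup.1 hw
  obtain rfl | ⟨v, x, rfl⟩ := w.eq_nil_or_concat
  · have := (hmem 0).2 (by omega)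
    simp at this
  rw [List.concat_eq_append] at *
  have hx : x ≤ n := by
    have := (hmem x).1 (by simp)
    omega
  have hv : ∀ a ∈ v, ∃ u, skip x u = a := fun a ha =>
    exists_skip_eq ((List.nodup_append.1 hnd).2.2 a ha x (by simp))
  obtain ⟨u, rfl⟩ : ∃ u : List ℕ, u.map (skip x) = v := by
    clear hnd hmem hw
    induction v with
    | nil => exact ⟨[], rfl⟩
    | cons a v ih =>
      obtain ⟨u, rfl⟩ := ih fun c hc => hv c (by simp [hc])
      obtain ⟨c, rfl⟩ := hv a (by simp)
      exact ⟨c :: u, rfl⟩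
  exact ⟨x, hx, u, (appendLetter_mem_words hx).1 hw, rfl⟩

theorem appendLetter_mem_stage {n m x : ℕ} (hm : m ≤ n) (hx : x ≤ n) {w : List ℕ} :
    appendLetter x w ∈ stage (n + 1) 0 m ↔ w ∈ stage n 0 m := by
  rw [mem_stage_zero, mem_stage_zero, appendLetter_mem_words hx]
  refine and_congr_right fun hw => ?_
  rw [appendLetter, List.take_append_of_le_length (by simpa [length_of_mem_words hw] using hm),
    ← List.map_take, List.pairwise_map]
  simp only [(skip_strictMono x).lt_iff_lt]

theorem sum_stage_zero_succ {M : Type*} [AddCommMonoid M] (F : List ℕ → M) {n m : ℕ}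
    (hm : m ≤ n) :
    ∑ w ∈ stage (n + 1) 0 m, F w =
      ∑ w ∈ stage n 0 m, ∑ x ∈ Finset.range (n + 1), F (appendLetter x w) := by
  rw [← Finset.sum_product']
  symm
  refine Finset.sum_bij (fun p _ => appendLetter p.2 p.1) (fun p hp => ?_)
    (fun p _ p' _ h => ?_) (fun w hw => ?_) fun _ _ => rfl
  · simp only [Finset.mem_product, Finset.mem_range] at hp
    exact (appendLetter_mem_stage hm (by omega)).2 hp.1
  · have := appendLetter_injective h
    exact Prod.ext this.2 this.1
  · obtain ⟨x, hx, v, hv, rfl⟩ := exists_appendLetter_eq (stage_subset_words _ _ _ hw)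
    refine ⟨(v, x), ?_, rfl⟩
    simp only [Finset.mem_product, Finset.mem_range]
    exact ⟨(appendLetter_mem_stage hm hx).1 hw, by omega⟩

theorem map_pair_sublist {f : ℕ → ℕ} (hf : f.Injective) {a c : ℕ} {w : List ℕ} :
    [f a, f c].Sublist (w.map f) ↔ [a, c].Sublist w := by
  refine ⟨fun h => ?_, fun h => by simpa using h.map f⟩
  obtain ⟨l, hl, h⟩ := List.sublist_map_iff.1 h
  rw [List.map_injective_iff.2 hf (a₁ := [a, c]) (a₂ := l) (by simpa using h)]
  exact hl

/-- Since x comes last, x + 1 precedes it whenever x < n, while x does not precede x - 1. Descents d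
< x of the old word stay, those with d > x move to d + 1, and the one at x, present or not, is
replaced by one at x + 1. -/
theorem inverseMajor_appendLetter {n x : ℕ} (hx : x ≤ n) {w : List ℕ} (hw : w ∈ words n) :
    inverseMajor (n + 1) (appendLetter x w) =
      ∑ d ∈ Finset.range n, if d < x then (if [d, d - 1].Sublist w then d else 0)
        else if d = x then x + 1 else if [d, d - 1].Sublist w then d + 1 else 0 := by
  obtain ⟨r, rfl⟩ := Nat.exists_eq_add_of_le hx
  have hmem := (mem_words_iff_nodup.1 hw).2
  have hinj := (skip_strictMono x).injective
  have key : ∀ d, [d, d - 1].Sublist (appendLetter x w) ↔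
      [d, d - 1].Sublist (w.map (skip x)) ∨ d ∈ w.map (skip x) ∧ d - 1 = x := fun d => by
    have h : ¬ [d, d - 1].Sublist [x] := fun h => by simpa using h.length_le
    rw [appendLetter, pair_sublist_append]
    simp [h]
  have hx₁ : ∀ c, ¬ [x, c].Sublist (w.map (skip x)) := fun c h =>
    notMem_map_skip x w (h.subset (by simp))
  rw [inverseMajor, add_assoc, Finset.sum_range_add _ x (r + 1), Finset.sum_range_add _ x r,
    Finset.sum_range_succ']
  congr 1
  · refine Finset.sum_congr rfl fun d hd => ?_
    have hd := Finset.mem_range.1 hd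
    rcases Nat.eq_zero_or_pos d with rfl | hd0
    · simp [hd]
    have h := map_pair_sublist hinj (a := d) (c := d - 1) (w := w)
    rw [skip_of_lt hd, skip_of_lt (by omega)] at h
    have h' : d - 1 ≠ x := by omega
    simp [key, h, h', hd]
  · have h0 : ¬ [x, x - 1].Sublist (appendLetter x w) := by
      rw [key]
      rintro (h | h)
      · exact hx₁ _ h
      · exact notMem_map_skip x w h.1
    rw [add_zero, if_neg h0, add_zero]
    refine Finset.sum_congr rfl fun e he => ?_
    have he := Finset.mem_range.1 he
    rcases Nat.eq_zero_or_pos e with rfl | he0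
    · have h : x + 1 ∈ w.map (skip x) := by
        rw [← skip_of_le le_rfl, List.mem_map_of_injective hinj, hmem]
        omega
      rw [if_pos ((key _).2 (Or.inr ⟨h, by omega⟩))]
      simp
    · have h := map_pair_sublist hinj (a := x + e) (c := x + e - 1) (w := w)
      rw [skip_of_le (by omega), skip_of_le (by omega)] at h
      have h₁ : x + (e + 1) - 1 ≠ x := by omega
      have h₂ : x + (e + 1) = x + e + 1 := by omega
      have h₃ : x + e - 1 + 1 = x + (e + 1) - 1 := by omega
      rw [h₃, ← h₂] at h
      have h₄ : ¬ x + e < x := by omega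
      have h₅ : x + e ≠ x := by omega
      simp only [key, h, h₁, h₄, h₅, and_false, or_false, if_false]
      rfl

/-- Carlitz's insertion lemma, in terms of the set of descents. -/
theorem sum_pow_insert {R : Type*} [CommRing R] (q : R) (E : ℕ → Prop) [DecidablePred E] (n : ℕ) :
    ∑ x ∈ Finset.range n, q ^ (∑ d ∈ Finset.range n, if d < x then (if E d then d else 0)
        else if d = x then x + 1 else if E d then d + 1 else 0) =
      q ^ (∑ d ∈ Finset.range n, if E d then d else 0) * (q * qInt q n) := by
  induction n with
  | zero => simp [qInt]
  | succ n ih =>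
    have h₁ : ∀ x ∈ Finset.range n,
        q ^ (∑ d ∈ Finset.range (n + 1), if d < x then (if E d then d else 0)
          else if d = x then x + 1 else if E d then d + 1 else 0) =
        q ^ (∑ d ∈ Finset.range n, if d < x then (if E d then d else 0)
          else if d = x then x + 1 else if E d then d + 1 else 0) *
          q ^ (if E n then n + 1 else 0) := fun x hx => by
      have := Finset.mem_range.1 hx
      rw [Finset.sum_range_succ, pow_add, if_neg (by omega), if_neg (by omega)]
    have h₂ : (∑ d ∈ Finset.range n, if d < n then (if E d then d else 0)
          else if d = n then n + 1 else if E d then d + 1 else 0) =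
        ∑ d ∈ Finset.range n, if E d then d else 0 :=
      Finset.sum_congr rfl fun d hd => if_pos (Finset.mem_range.1 hd)
    rw [Finset.sum_range_succ, Finset.sum_congr rfl h₁, ← Finset.sum_mul, ih,
      Finset.sum_range_succ, Finset.sum_range_succ, h₂, if_neg (lt_irrefl n), if_pos rfl]
    -- The exponents for x < n gain n + 1 if E n holds and 0 otherwise, while x = n always
    -- contributes n + 1. The two cases build `[n + 1]` from `[n]` by adding a term at the bottom or
    -- at the top.
    by_cases hE : E n
    · simp only [hE, if_true, qInt, geom_sum_succ (n := n)]
      ring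
    · simp only [hE, if_false, qInt, Finset.sum_range_succ _ n]
      ring

/-- The letters x < n contribute q[n] by `sum_pow_insert`, and x = n leaves the index unchanged and
contributes 1; the sum of the two is [n + 1]. -/
theorem sum_pow_inverseMajor_appendLetter {R : Type*} [CommRing R] (q : R) {n : ℕ} {w : List ℕ}
    (hw : w ∈ words n) :
    ∑ x ∈ Finset.range (n + 1), q ^ inverseMajor (n + 1) (appendLetter x w) =
      qInt q (n + 1) * q ^ inverseMajor n w := by
  rw [Finset.sum_congr rfl fun x hx => by
    rw [inverseMajor_appendLetter (Nat.lt_succ_iff.1 (Finset.mem_range.1 hx)) hw],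
    Finset.sum_range_succ, sum_pow_insert q (fun d => [d, d - 1].Sublist w)]
  have h : (∑ d ∈ Finset.range n, if d < n then (if [d, d - 1].Sublist w then d else 0)
      else if d = n then n + 1 else if [d, d - 1].Sublist w then d + 1 else 0) =
      inverseMajor n w :=
    (Finset.sum_congr rfl fun d hd => if_pos (Finset.mem_range.1 hd)).trans
      (by rw [inverseMajor])
  have h' : (∑ d ∈ Finset.range n, if [d, d - 1].Sublist w then d else 0) = inverseMajor n w := by
    rw [inverseMajor]
  rw [h, h', qInt, qInt, geom_sum_succ]
  ring

theorem stage_zero_self (n : ℕ) : stage n 0 n = {List.range n} := by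
  ext w
  rw [mem_stage_zero, Finset.mem_singleton]
  constructor
  · rintro ⟨hw, hp⟩
    rw [List.take_of_length_le (length_of_mem_words hw).le] at hp
    exact (mem_words.1 hw).eq_of_pairwise (fun a b _ _ h h' => by omega) hp
      List.pairwise_lt_range
  · rintro rfl
    exact ⟨mem_words.2 (List.Perm.refl _), List.pairwise_lt_range.sublist (List.take_sublist _ _)⟩

theorem inverseMajor_range (n : ℕ) : inverseMajor n (List.range n) = 0 := by
  rw [inverseMajor]
  exact Finset.sum_eq_zero fun d _ => if_neg (not_pair_sublist List.pairwise_lt_range)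

/-- Deleting the last letter lowers n and k together, so the length n - k of the increasing prefix
is unchanged; at k = 0 only the identity word is left. -/
theorem sum_stage_zero_pow_inverseMajor {R : Type*} [CommRing R] (q : R) (k : ℕ) :
    ∀ n : ℕ, k ≤ n → ∑ w ∈ stage n 0 (n - k), q ^ inverseMajor n w =
      ∏ j ∈ Finset.range k, qInt q (n - j) := by
  induction k with
  | zero =>
    intro n _
    simp [stage_zero_self, inverseMajor_range]
  | succ k ih =>
    rintro (_ | n) h
    · omega
    rw [Nat.add_sub_add_right, sum_stage_zero_succ _ (Nat.sub_le n k),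
      Finset.sum_congr rfl fun w hw =>
        sum_pow_inverseMajor_appendLetter q (stage_subset_words _ _ _ hw),
      ← Finset.mul_sum, ih n (by omega), Finset.prod_range_succ', mul_comm]
    simp

/-! ### Translation between permutations and words -/

/-- The one-line notation of a permutation. -/
def oneLine {n : ℕ} (σ : Equiv.Perm (Fin n)) : List ℕ := (List.finRange n).map fun i => (σ i : ℕ)

theorem oneLine_injective {n : ℕ} : Function.Injective (oneLine (n := n)) := by
  intro σ τ h
  refine Equiv.ext fun i => Fin.ext ?_
  exact List.map_inj_left.1 h i (List.mem_finRange i)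

theorem mem_oneLine {n : ℕ} (σ : Equiv.Perm (Fin n)) (a : ℕ) : a ∈ oneLine σ ↔ a < n := by
  simp only [oneLine, List.mem_map, List.mem_finRange, true_and]
  constructor
  · rintro ⟨i, rfl⟩
    exact (σ i).2
  · exact fun h => ⟨σ.symm ⟨a, h⟩, by simp⟩

theorem oneLine_mem_words {n : ℕ} (σ : Equiv.Perm (Fin n)) : oneLine σ ∈ words n := by
  rw [mem_words_iff_nodup]
  refine ⟨?_, mem_oneLine σ⟩
  exact (List.nodup_finRange n).map (Fin.val_injective.comp σ.injective)

theorem exists_oneLine_eq {n : ℕ} {w : List ℕ} (hw : w ∈ words n) :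
    ∃ σ : Equiv.Perm (Fin n), oneLine σ = w := by
  obtain ⟨hnd, hmem⟩ := mem_words_iff_nodup.1 hw
  have hl := length_of_mem_words hw
  subst hl
  let f : Fin w.length → Fin w.length := fun i => ⟨w.get i, (hmem _).1 (List.get_mem w i)⟩
  have hf : Function.Injective f := fun i j h =>
    (List.nodup_iff_injective_get.1 hnd) (congrArg Fin.val h)
  refine ⟨Equiv.ofBijective f (Finite.injective_iff_bijective.1 hf), ?_⟩
  simp [oneLine, f, ← List.ofFn_eq_map]

theorem sum_words_eq_sum_perm {M : Type*} [AddCommMonoid M] (n : ℕ) (F : List ℕ → M) :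
    ∑ w ∈ words n, F w = ∑ σ : Equiv.Perm (Fin n), F (oneLine σ) := by
  symm
  refine Finset.sum_bij (fun σ _ => oneLine σ) (fun σ _ => oneLine_mem_words σ)
    (fun _ _ _ _ h => oneLine_injective h) (fun w hw => ?_) fun _ _ => rfl
  obtain ⟨σ, rfl⟩ := exists_oneLine_eq hw
  exact ⟨σ, Finset.mem_univ _, rfl⟩

theorem pair_sublist_oneLine {n : ℕ} (σ : Equiv.Perm (Fin n)) (a c : Fin n) :
    [(a : ℕ), (c : ℕ)].Sublist (oneLine σ) ↔ σ⁻¹ a < σ⁻¹ c := by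
  constructor
  · intro h
    obtain ⟨l, hl, h⟩ := List.sublist_map_iff.1 h
    obtain ⟨i, j, rfl⟩ := List.length_eq_two.1
      (show l.length = 2 by simpa using (congrArg List.length h).symm)
    simp only [List.map_cons, List.map_nil, List.cons.injEq, and_true] at h
    have hi : a = σ i := Fin.ext h.1
    have hj : c = σ j := Fin.ext h.2
    have := (List.pairwise_lt_finRange n).sublist hl
    simpa [hi, hj] using this
  · intro h
    have : [σ⁻¹ a, σ⁻¹ c].Sublist (List.finRange n) := by
      refine List.sublist_of_subperm_of_pairwise (r := (· < ·)) ?_ ?_ (List.pairwise_lt_finRange n)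
      · exact List.subperm_of_subset (by simpa using h.ne) fun i _ => List.mem_finRange i
      · simpa using h
    simpa [oneLine] using this.map fun i => (σ i : ℕ)

theorem inverseMajor_oneLine {n : ℕ} (σ : Equiv.Perm (Fin n)) :
    inverseMajor n (oneLine σ) = majorIndex σ⁻¹ := by
  have hn : ¬ [n, n - 1].Sublist (oneLine σ) := fun h => by
    have := (mem_oneLine σ n).1 (h.subset (by simp))
    omega
  -- The term d = n is added, which vanishes because n is not a letter, and the term d = 0 is
  -- dropped, which has weight 0. The substitution d = i + 1 then matches letters with positions
  -- counted from 1.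
  have h := Finset.sum_range_succ (fun d => if [d, d - 1].Sublist (oneLine σ) then d else 0) n
  rw [Finset.sum_range_succ'] at h
  simp only [hn, if_false, ite_self, add_zero, Nat.add_sub_cancel] at h
  rw [inverseMajor, ← h, ← Fin.sum_univ_eq_sum_range
    (fun d => if [d + 1, d].Sublist (oneLine σ) then d + 1 else 0), majorIndex]
  refine Finset.sum_congr rfl fun i _ => ?_
  congr 1
  refine propext ⟨fun h => ?_, fun ⟨hi, h⟩ => ?_⟩
  · have hi : (i : ℕ) + 1 < n := (mem_oneLine σ _).1 (h.subset (by simp))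
    exact ⟨hi, (pair_sublist_oneLine σ ⟨i + 1, hi⟩ i).1 h⟩
  · exact (pair_sublist_oneLine σ ⟨i + 1, hi⟩ i).2 h

theorem incLE_oneLine {n m : ℕ} (σ : Equiv.Perm (Fin n)) :
    IncLE m (oneLine σ) ↔ maxIncreasing σ ≤ m := by
  rw [maxIncreasing, Finset.sup_le_iff]
  simp only [Finset.mem_filter, Finset.mem_univ, true_and]
  constructor
  · intro h s hs
    have hf : ((List.finRange n).filter (· ∈ s)).Pairwise (· < ·) :=
      (List.pairwise_lt_finRange n).sublist List.filter_sublist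
    have := h (((List.finRange n).filter (· ∈ s)).map fun i => (σ i : ℕ))
      (List.filter_sublist.map _) (by
        rw [List.pairwise_map]
        refine hf.imp_of_mem fun {i j} hi hj hij => hs i ?_ j ?_ hij
        · simpa using hi
        · simpa using hj)
    rw [List.length_map] at this
    refine le_of_eq_of_le ?_ this
    rw [← List.toFinset_card_of_nodup ((List.nodup_finRange n).filter _)]
    congr 1
    ext i
    simp
  · intro h s hs hp
    obtain ⟨l, hl, rfl⟩ := List.sublist_map_iff.1 hs
    rw [List.pairwise_map] at hp
    have hlt := (List.pairwise_lt_finRange n).sublist hl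
    rw [List.length_map, ← List.toFinset_card_of_nodup ((List.nodup_finRange n).sublist hl)]
    refine h _ fun i hi j hj => ?_
    -- The relation is symmetrized so that its validity along the list gives it for every pair of
    -- members, in either order.
    let r : Fin n → Fin n → Prop := fun i j => (i < j → σ i < σ j) ∧ (j < i → σ j < σ i)
    have : Std.Symm r := ⟨fun i j h => ⟨h.2, h.1⟩⟩
    have := List.Pairwise.forall_of_forall (R := r) (l := l) (fun i _ => by simp [r])
      ((hp.and hlt).imp fun {i j} h => ⟨fun _ => h.1, fun h' => absurd h' h.2.le.not_gt⟩)
    exact (this (List.mem_toFinset.1 hi) (List.mem_toFinset.1 hj)).1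

theorem pairwise_take_oneLine {n m : ℕ} (σ : Equiv.Perm (Fin n)) :
    ((oneLine σ).take m).Pairwise (· < ·) ↔ ∀ i j : Fin n, i < j → (j : ℕ) < m → σ i < σ j := by
  rw [List.pairwise_iff_getElem]
  simp only [oneLine, List.length_take, List.length_map, List.length_finRange, List.getElem_take,
    List.getElem_map, List.getElem_finRange, lt_min_iff]
  exact ⟨fun h i j hij hj => h i j ⟨by omega, i.2⟩ ⟨hj, j.2⟩ hij,
    fun h i j hi hj hij => h ⟨i, hi.2⟩ ⟨j, hj.2⟩ hij hj.1⟩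

/-- Only the upper bound on is(w) has to be imposed: the increasing prefix already has length n - k.
-/
theorem mem_PiSet_iff {n k : ℕ} (σ : Equiv.Perm (Fin n)) :
    σ ∈ PiSet n k ↔ oneLine σ ∈ stage n 0 (n - k) ∧ IncLE (n - k) (oneLine σ) := by
  rw [PiSet, Finset.mem_filter, mem_stage_zero, incLE_oneLine, pairwise_take_oneLine]
  simp only [Finset.mem_univ, oneLine_mem_words, true_and]
  refine and_congr_right fun h => ⟨fun h' => h'.le, fun h' => h'.antisymm ?_⟩
  have := (incLE_oneLine σ).2 le_rfl _ (List.take_sublist (n - k) _) ((pairwise_take_oneLine σ).2 h)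
  rw [List.length_take, length_of_mem_words (oneLine_mem_words σ)] at this
  omega

/-! ### Evaluation of the terminal stages and conclusion -/

theorem BumpRel.incLE_iff {j m a : ℕ} {w w' : List ℕ} (h : BumpRel j m w w') :
    IncLE a w ↔ IncLE a w' := by
  obtain ⟨b, r₁, y, r₂, x, l, -, -, hB, rfl, rfl⟩ := h
  exact hB.incLE_iff a b l

theorem bumpInvariant_pow_inverseMajor {R : Type*} [CommRing R] (q : R) (n : ℕ) :
    BumpInvariant fun w => q ^ inverseMajor n w := by
  rintro j m w w' ⟨b, r₁, y, r₂, x, l, -, -, hB, rfl, rfl⟩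
  exact congrArg (q ^ ·) (hB.inverseMajor_eq n b l)

theorem mem_stage_self {n j : ℕ} (hj : j ≤ n) {w : List ℕ} : w ∈ stage n j (n - j) ↔
    w ∈ words n ∧ (w.drop j).Pairwise (· < ·) ∧ IncLE (n - j) w := by
  rw [mem_stage]
  refine and_congr_right fun hw => ?_
  have := length_of_mem_words hw
  rw [List.take_of_length_le (by simp; omega), List.take_of_length_le (by omega)]

theorem sum_PiSet {R : Type*} [CommRing R] (q : R) {n k : ℕ} (h : 2 * k ≤ n) :
    ∑ σ ∈ PiSet n k, q ^ majorIndex σ⁻¹ = ∑ w ∈ stage n k (n - k), q ^ inverseMajor n w := by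
  classical
  let g : List ℕ → R := fun w => if IncLE (n - k) w then q ^ inverseMajor n w else 0
  have hg : BumpInvariant g := fun j m w w' hR => by
    have h' := bumpInvariant_pow_inverseMajor q n j m w w' hR
    simp only at h'
    simp only [g, hR.incLE_iff, h']
  have h₁ : ∑ σ ∈ PiSet n k, q ^ majorIndex σ⁻¹ = ∑ w ∈ stage n 0 (n - k), g w := by
    rw [← Finset.inter_eq_right.2 (stage_subset_words n 0 (n - k)), ← Finset.sum_ite_mem,
      sum_words_eq_sum_perm, ← Finset.univ_inter (PiSet n k), ← Finset.sum_ite_mem]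
    refine Finset.sum_congr rfl fun σ _ => ?_
    simp only [mem_PiSet_iff, g, inverseMajor_oneLine, ite_and]
  rw [h₁, sum_stage hg (i := k) (by omega) (by omega),
    Finset.sum_eq_single (k, 0) (fun a ha hne => ?_) (fun hn => ?_)]
  · simp only [Nat.choose_self, Nat.cast_one, one_mul, zero_add, add_zero]
    exact Finset.sum_congr rfl fun w hw => if_pos ((mem_stage_self (by omega)).1 hw).2.2
  · have ha := Finset.HasAntidiagonal.mem_antidiagonal.1 ha
    have h₂ : a.2 ≠ 0 := fun h₂ => hne (Prod.ext (by simpa [h₂] using ha) h₂)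
    -- If a.2 > 0, the final row is an increasing subsequence of length n - a.1 > n - k, so the
    -- restricted weight is zero.
    rw [Finset.sum_eq_zero, mul_zero]
    intro w hw
    rw [zero_add, show n - k + a.2 = n - a.1 by omega, mem_stage_self (by omega)] at hw
    refine if_neg fun h' => ?_
    have := h' _ (List.drop_sublist _ _) hw.2.1
    rw [List.length_drop, length_of_mem_words hw.1] at this
    omega
  · exact absurd (Finset.HasAntidiagonal.mem_antidiagonal.2 (by simp)) hn

theorem proposition2 {R : Type*} [CommRing R] (q : R) (n k : ℕ) (hnk : 2 * k ≤ n) :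
    ∑ s ∈ Finset.range (k + 1),
        (k.choose s : R) * ∑ w ∈ PiSet n (k - s), q ^ majorIndex w⁻¹ =
      ∏ j ∈ Finset.range k, qInt q (n - j) := by
  rw [← sum_stage_zero_pow_inverseMajor q k n (by omega),
    sum_stage (bumpInvariant_pow_inverseMajor q n) (i := k) (by omega) (by omega),
    -- The stages are indexed by the number k - s of bumps, hence the reflection of the range and
    -- the symmetry of the binomial coefficients.
    Finset.Nat.sum_antidiagonal_eq_sum_range_succ_mk, ← Finset.sum_range_reflect]
  refine Finset.sum_congr rfl fun s hs => ?_
  have hs := Finset.mem_range.1 hs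
  rw [show k + 1 - 1 - s = k - s by omega, Nat.choose_symm (by omega),
    show k - (k - s) = s by omega, sum_PiSet q (by omega), zero_add]
  dsimp only
  rw [show n - k + (k - s) = n - s by omega]
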